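/- Let $V$ be a complex vector space of finite dimension $n$ equipped with a nondegenerate symmetric bilinear form $(\cdot|\cdot)$, and let $S^3V \subseteq V \otimes V \otimes V$ be the space of symmetric tensors. Every $T \in S^3V$ defines a multiplication $\mu_T : V \times V \to V$ by identifying $V$ with $V^*$ via $v \mapsto (v|\cdot)$ in the first two tensor factors; thus $\mu_T$ is linear in $T$, and $\mu_T(x,y) = (x|u)(y|v)\,w$ for $T = u \otimes v \otimes w$. Let $$X(V) := \{T \in S^3V \mid \mu_T \text{ is associative}\}.$$ A subspace $U \subseteq V$ is isotropic if $(u|v)=0$ for all $u,v \in U$. Let $Z(V) \subseteq S^3V$ be the union of the subspaces $S^3U$ over all maximal isotropic subspaces $U \subseteq V$; this equals the union of the $S^3U$ over all isotropic subspaces $U \subseteq V$. Then $Z(V) \subseteq X(V)$, and $Z(V)$ is a Zariski-closed subset of $S^3V$ (an affine variety, not necessarily irreducible) of dimension $$\binom{\lfloor n/2 \rfloor + 2}{3} + \binom{\lceil n/2 \rceil}{2}.$$ -/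

import Mathlib

open scoped TensorProduct

noncomputable section

namespace Odeco

section Tensors

variable (V : Type*) [AddCommGroup V] [Module ℂ V]

/-- The space `S³ V ⊆ V ⊗ V ⊗ V` of symmetric tensors. Invariance under the transpositions of the
first two and of the last two tensor factors is invariance under all permutations of the factors. -/
def symCube : Submodule ℂ (V ⊗[ℂ] (V ⊗[ℂ] V)) where
  carrier := {T | TensorProduct.leftComm ℂ V V V T = T ∧
    (TensorProduct.comm ℂ V V).toLinearMap.lTensor V T = T}
  add_mem' := by
    rintro a b ⟨ha, ha'⟩ ⟨hb, hb'⟩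
    exact ⟨by rw [map_add, ha, hb], by rw [map_add, ha', hb']⟩
  zero_mem' := ⟨map_zero _, map_zero _⟩
  smul_mem' := by
    rintro c a ⟨ha, ha'⟩
    exact ⟨by rw [map_smul, ha], by rw [map_smul, ha']⟩

variable {V}

/-- For a subspace `U ⊆ V`, the space `S³ U` regarded as a subspace of `S³ V`: the symmetric
tensors on `V` that are images of symmetric tensors on `U` under the inclusion
`U ⊗ U ⊗ U → V ⊗ V ⊗ V`. -/
def symCubeOf (U : Submodule ℂ V) : Submodule ℂ (symCube V) :=
  ((symCube U).map (TensorProduct.map U.subtype (TensorProduct.map U.subtype U.subtype))).comap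
    (symCube V).subtype

/-- The multiplication `μ_T : V × V → V` associated with a tensor `T ∈ V ⊗ V ⊗ V` and a bilinear
form `B`: the first two tensor factors are turned into linear forms on `V` by `v ↦ B(·, v)`
and evaluated at `x` and `y`. So `μ_T(x, y) = B(x, u) B(y, v) w` for `T = u ⊗ v ⊗ w`. -/
def mu (B : LinearMap.BilinForm ℂ V) (T : V ⊗[ℂ] (V ⊗[ℂ] V)) (x y : V) : V :=
  TensorProduct.lid ℂ V (TensorProduct.map (B x)
    ((TensorProduct.lid ℂ V).toLinearMap ∘ₗ TensorProduct.map (B y) LinearMap.id) T)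

/-- The variety `X(V)`: the symmetric tensors `T` for which `μ_T` is associative. -/
def varX (B : LinearMap.BilinForm ℂ V) : Set (symCube V) :=
  {T | ∀ x y z : V, mu B T x (mu B T y z) = mu B T (mu B T x y) z}

/-- A subspace is isotropic if the form vanishes identically on it. -/
def IsIsotropic (B : LinearMap.BilinForm ℂ V) (U : Submodule ℂ V) : Prop :=
  ∀ u ∈ U, ∀ v ∈ U, B u v = 0

/-- `Z(V)`: the union of the spaces `S³ U` over all maximal isotropic subspaces `U` of `V`
(isotropic subspaces that are maximal with respect to inclusion). -/
def varZ (B : LinearMap.BilinForm ℂ V) : Set (symCube V) :=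
  {T | ∃ U : Submodule ℂ V, Maximal (IsIsotropic B) U ∧ T ∈ symCubeOf U}

end Tensors

section AffineVarieties

/-- The algebra `ℂ[W]` of polynomial functions on a complex vector space `W`: the algebra of
functions `W → ℂ` generated by the linear forms. -/
def polyFun (W : Type*) [AddCommGroup W] [Module ℂ W] : Subalgebra ℂ (W → ℂ) :=
  Algebra.adjoin ℂ (Set.range fun φ : Module.Dual ℂ W => (φ : W → ℂ))

variable {W : Type*} [AddCommGroup W] [Module ℂ W]

/-- A subset of `W` is Zariski closed (an affine variety in `W`, not necessarily irreducible) if it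
is the common zero set of a set of polynomial functions. -/
def IsZariskiClosed (Z : Set W) : Prop :=
  ∃ S : Set (polyFun W), Z = {w | ∀ f ∈ S, (f : W → ℂ) w = 0}

/-- The ideal of `ℂ[W]` of all polynomial functions that vanish on `Z`. -/
def vanishingIdeal (Z : Set W) : Ideal (polyFun W) where
  carrier := {f | ∀ w ∈ Z, (f : W → ℂ) w = 0}
  add_mem' := by
    intro f g hf hg w hw
    simp [hf w hw, hg w hw]
  zero_mem' := by
    intro w _
    simp
  smul_mem' := by
    intro c f hf w hw
    simp [hf w hw]

/-- The coordinate ring `ℂ[Z] = ℂ[W] / I(Z)`. -/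
abbrev CoordinateRing (Z : Set W) : Type _ := polyFun W ⧸ vanishingIdeal Z

/-- The dimension of an affine variety `Z ⊆ W`: the Krull dimension of its coordinate ring. -/
def affineDim (Z : Set W) : WithBot ℕ∞ := ringKrullDim (CoordinateRing Z)

end AffineVarieties

end Odeco

end

/-! A symmetric tensor T lies in S³U exactly when all its contractions with two linear forms lie in
U, and by nondegeneracy these contractions are the products μ_T(x, y). If U is isotropic, every
product lies in U and every product with a factor in U vanishes, so both bracketings of a triple
product are 0: Z ⊆ X. Likewise T ∈ Z iff any two products are orthogonal (`mem_varZ_iff`), a system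
of quadratic equations in T, so Z is closed.

For the dimension, write n = 2m + ε with ε ∈ {0, 1}. Over ℂ, V is isometric to m hyperbolic planes
plus an orthonormal remainder of dimension ε (`exists_isometry_hypSpace`). After interchanging the
two isotropic vectors in some of the planes, a given isotropic subspace projects injectively to the
first component ℂ^m (`exists_hypSwap_injOn`). It then lies in a graph x ↦ (x, Gx, Lx) with G + Gᵀ +
LᵀL = 0, that is, G = S − ½LᵀL with S skew. Adding a tensor in S³ℂ^m to the data (S, L) covers Z by
2^m polynomial maps from a space of dimension C(m+2, 3) + C(m, 2) + εm (`exists_param_eq`).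

The dimension of Z is at most that of the parameter space, since algebraic relations on the separate
charts multiply to one on Z (`affineDim_le_finrank`). Equality holds because on one chart the
parameters are algebraic over the functions pulled back from Z (`isAlgebraic_comap_param`). Noether
normalization turns both statements into Krull dimension. -/

noncomputable section

namespace Odeco

/-! ### Krull dimension, algebraic independence and transcendence degree. -/

section KrullDimension

/-- Lying over and going up lift chains of primes from R to S; incomparability keeps chains strict
under contraction. -/
theorem ringKrullDim_eq_of_isIntegral {R S : Type*} [CommRing R] [CommRing S] [Algebra R S]
    [Algebra.IsIntegral R S] [FaithfulSMul R S] : ringKrullDim R = ringKrullDim S := by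
  apply le_antisymm
  · refine iSup_le fun l => ?_
    obtain ⟨⟨P, hP, hPl⟩⟩ := Ideal.nonempty_primesOver (S := S) l.head.asIdeal
    obtain ⟨L, hL, -⟩ := Ideal.exists_ltSeries_of_hasGoingUp l P
    rw [← hL]
    exact le_iSup (fun q : LTSeries (PrimeSpectrum S) => (q.length : WithBot ℕ∞)) L
  · refine Order.krullDim_le_of_strictMono (PrimeSpectrum.comap (algebraMap R S)) ?_
    intro p q hpq
    obtain ⟨x, hx⟩ := SetLike.exists_of_lt (show p.asIdeal < q.asIdeal from hpq)
    exact Ideal.comap_lt_comap_of_integral_mem_sdiff (I := p.asIdeal) (J := q.asIdeal) hpq.le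
      ⟨hx.1, hx.2⟩
      (Algebra.IsIntegral.isIntegral x)

variable (k : Type*) [Field k]

theorem exists_integral_mvPolynomial_ringKrullDim_eq (R : Type*) [CommRing R] [Nontrivial R]
    [Algebra k R] [Algebra.FiniteType k R] :
    ∃ (s : ℕ) (g : MvPolynomial (Fin s) k →ₐ[k] R),
      Function.Injective g ∧ g.IsIntegral ∧ ringKrullDim R = s := by
  obtain ⟨s, g, hinj, hint⟩ := exists_integral_inj_algHom_of_fg k R
  refine ⟨s, g, hinj, hint, ?_⟩
  algebraize [g.toRingHom]
  have : FaithfulSMul (MvPolynomial (Fin s) k) R :=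
    (faithfulSMul_iff_algebraMap_injective _ _).2 hinj
  rw [← ringKrullDim_eq_of_isIntegral (R := MvPolynomial (Fin s) k) (S := R),
    MvPolynomial.ringKrullDim_of_isNoetherianRing, ringKrullDim_eq_zero_of_field]
  simp

theorem ringKrullDim_le_of_algebraicIndependent (R : Type*) [CommRing R] [Nontrivial R]
    [Algebra k R] [Algebra.FiniteType k R] (d : ℕ)
    (h : ∀ (s : ℕ) (x : Fin s → R), AlgebraicIndependent k x → s ≤ d) :
    ringKrullDim R ≤ d := by
  obtain ⟨s, g, hinj, -, hdim⟩ := exists_integral_mvPolynomial_ringKrullDim_eq k R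
  rw [hdim]
  have := h s (fun i => g (MvPolynomial.X i)) (by
    have := (MvPolynomial.algebraicIndependent_X (Fin s) k).map' hinj
    exact this)
  exact_mod_cast this

/-- A Noether normalization of the image of f has s variables, and A is algebraic over it, so s is
the transcendence degree of A. The image is a quotient of R, so its dimension s bounds that of R
from below. -/
theorem trdeg_le_ringKrullDim {R A : Type*} [CommRing R] [CommRing A] [IsDomain A] [Algebra k R]
    [Algebra k A] [Algebra.FiniteType k R] (f : R →ₐ[k] A) [Algebra.IsAlgebraic f.range A] (d : ℕ)
    (hd : Algebra.trdeg k A = d) : (d : WithBot ℕ∞) ≤ ringKrullDim R := by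
  have : Algebra.FiniteType k f.range :=
    Algebra.FiniteType.of_surjective f.rangeRestrict f.rangeRestrict_surjective
  obtain ⟨s, g, hinj, hint, hdim⟩ := exists_integral_mvPolynomial_ringKrullDim_eq k f.range
  refine le_trans (le_of_eq ?_)
    (ringKrullDim_le_of_surjective f.rangeRestrict.toRingHom f.rangeRestrict_surjective)
  rw [hdim]
  algebraize [g.toRingHom, f.range.val.toRingHom.comp g.toRingHom]
  have : FaithfulSMul (MvPolynomial (Fin s) k) f.range :=
    (faithfulSMul_iff_algebraMap_injective _ _).2 hinj
  have hinj' : Function.Injective (algebraMap (MvPolynomial (Fin s) k) A) :=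
    Subtype.val_injective.comp hinj
  have : FaithfulSMul (MvPolynomial (Fin s) k) A :=
    (faithfulSMul_iff_algebraMap_injective _ _).2 hinj'
  have : IsScalarTower (MvPolynomial (Fin s) k) f.range A := IsScalarTower.of_algebraMap_eq' rfl
  have : Algebra.IsAlgebraic (MvPolynomial (Fin s) k) A :=
    Algebra.IsAlgebraic.trans _ f.range _
  have : IsScalarTower k (MvPolynomial (Fin s) k) A :=
    IsScalarTower.of_algHom (f.range.val.comp g)
  have h := lift_trdeg_add_eq k (MvPolynomial (Fin s) k) A
  rw [trdeg_eq_zero (R := MvPolynomial (Fin s) k) (A := A), MvPolynomial.trdeg_of_isDomain, hd] at h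
  simp at h
  exact_mod_cast h.symm

end KrullDimension

/-! ### Polynomial functions as polynomials in coordinates. -/

section PolynomialFunctions

variable {W : Type*} [AddCommGroup W] [Module ℂ W]

theorem dual_mem_polyFun (φ : Module.Dual ℂ W) : (φ : W → ℂ) ∈ polyFun W :=
  Algebra.subset_adjoin ⟨φ, rfl⟩

/-- A linear form as a polynomial function. -/
def polyFunOfDual (φ : Module.Dual ℂ W) : polyFun W := ⟨φ, dual_mem_polyFun φ⟩

@[simp] theorem polyFunOfDual_apply (φ : Module.Dual ℂ W) (w : W) :
    (polyFunOfDual φ : W → ℂ) w = φ w := rfl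

/-- Evaluation of polynomials in the coordinates of a basis. -/
def polyFunOfBasis {ι : Type*} (b : Module.Basis ι ℂ W) : MvPolynomial ι ℂ →ₐ[ℂ] polyFun W :=
  MvPolynomial.aeval fun i => polyFunOfDual (b.coord i)

theorem polyFunOfBasis_apply {ι : Type*} (b : Module.Basis ι ℂ W) (p : MvPolynomial ι ℂ) (w : W) :
    (polyFunOfBasis b p : W → ℂ) w = MvPolynomial.eval (fun i => b.repr w i) p := by
  induction p using MvPolynomial.induction_on with
  | C a =>
    simp only [polyFunOfBasis, MvPolynomial.aeval_C, MvPolynomial.eval_C]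
    rfl
  | add p q hp hq => simp [hp, hq]
  | mul_X p i hp =>
    simp only [map_mul, MvPolynomial.eval_X, ← hp]
    simp [polyFunOfBasis]

theorem polyFunOfBasis_injective {ι : Type*} [Finite ι] (b : Module.Basis ι ℂ W) :
    Function.Injective (polyFunOfBasis b) := by
  intro p q h
  refine MvPolynomial.funext fun x => ?_
  have := Fintype.ofFinite ι
  have h1 := congrFun (congrArg Subtype.val h) (b.equivFun.symm x)
  rw [polyFunOfBasis_apply, polyFunOfBasis_apply] at h1
  have h2 : ∀ i, b.repr (b.equivFun.symm x) i = x i := fun i => by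
    rw [← b.equivFun_apply, LinearEquiv.apply_symm_apply]
  simpa only [h2] using h1

theorem polyFunOfBasis_surjective {ι : Type*} [Finite ι] (b : Module.Basis ι ℂ W) :
    Function.Surjective (polyFunOfBasis b) := by
  have := Fintype.ofFinite ι
  rintro ⟨f, hf⟩
  suffices h : polyFun W ≤ ((polyFun W).val.comp (polyFunOfBasis b)).range by
    obtain ⟨p, hp⟩ := h hf
    exact ⟨p, Subtype.ext hp⟩
  refine Algebra.adjoin_le ?_
  rintro _ ⟨φ, rfl⟩
  refine ⟨∑ i, MvPolynomial.C (φ (b i)) * MvPolynomial.X i, ?_⟩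
  ext w
  change (polyFunOfBasis b _ : W → ℂ) w = φ w
  rw [polyFunOfBasis_apply]
  conv_rhs => rw [← b.sum_repr w]
  simp only [map_sum, map_mul, MvPolynomial.eval_C, MvPolynomial.eval_X, map_smul, smul_eq_mul,
    mul_comm]

/-- Polynomial functions are polynomials in the coordinates of a basis. -/
def polyFunEquiv {ι : Type*} [Finite ι] (b : Module.Basis ι ℂ W) :
    MvPolynomial ι ℂ ≃ₐ[ℂ] polyFun W :=
  AlgEquiv.ofBijective (polyFunOfBasis b) ⟨polyFunOfBasis_injective b, polyFunOfBasis_surjective b⟩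

variable [FiniteDimensional ℂ W]

instance : IsDomain (polyFun W) :=
  (polyFunEquiv (Module.finBasis ℂ W)).symm.injective.isDomain
    (polyFunEquiv (Module.finBasis ℂ W)).symm.toRingEquiv.toRingHom

instance : Algebra.FiniteType ℂ (polyFun W) :=
  Algebra.FiniteType.equiv inferInstance (polyFunEquiv (Module.finBasis ℂ W))

theorem trdeg_polyFun : Algebra.trdeg ℂ (polyFun W) = Module.finrank ℂ W := by
  have := (polyFunEquiv (Module.finBasis ℂ W)).lift_trdeg_eq
  rw [MvPolynomial.trdeg_of_isDomain] at this
  simpa using this.symm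

theorem exists_relation_polyFun {s : ℕ} (hs : Module.finrank ℂ W < s) (f : Fin s → polyFun W) :
    ∃ F : MvPolynomial (Fin s) ℂ, F ≠ 0 ∧ MvPolynomial.aeval f F = 0 := by
  by_contra! h
  have hf : AlgebraicIndependent ℂ f :=
    (injective_iff_map_eq_zero _).2 fun F hF => by_contra fun h0 => h F h0 hF
  have := hf.lift_cardinalMk_le_trdeg
  rw [trdeg_polyFun] at this
  simp only [Cardinal.mk_fin, Cardinal.lift_natCast, Nat.cast_le] at this
  omega

end PolynomialFunctions

/-! ### Polynomial maps and pull-back of functions. -/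

section PolynomialMaps

variable {P W E F G : Type*} [AddCommGroup P] [Module ℂ P] [AddCommGroup W] [Module ℂ W]
  [AddCommGroup E] [Module ℂ E] [AddCommGroup F] [Module ℂ F] [AddCommGroup G] [Module ℂ G]

/-- A map between vector spaces is polynomial if its composites with linear forms are polynomial
functions. -/
def IsPolyMap (f : P → W) : Prop := ∀ θ : Module.Dual ℂ W, (fun p => θ (f p)) ∈ polyFun P

theorem isPolyMap_linear (f : P →ₗ[ℂ] W) : IsPolyMap f := fun θ => dual_mem_polyFun (θ ∘ₗ f)

theorem IsPolyMap.add {f g : P → W} (hf : IsPolyMap f) (hg : IsPolyMap g) :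
    IsPolyMap fun p => f p + g p := fun θ => by
  simp only [map_add]
  exact add_mem (hf θ) (hg θ)

theorem isPolyMap_const (w : W) : IsPolyMap fun _ : P => w :=
  fun θ => (polyFun P).algebraMap_mem (θ w)

theorem IsPolyMap.linear_comp {f : P → E} (hf : IsPolyMap f) (g : E →ₗ[ℂ] F) :
    IsPolyMap fun p => g (f p) := fun θ => hf (θ ∘ₗ g)

theorem IsPolyMap.bilinear [FiniteDimensional ℂ E] {f : P → E} {g : P → F}
    (hf : IsPolyMap f) (hg : IsPolyMap g) (β : E →ₗ[ℂ] F →ₗ[ℂ] G) :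
    IsPolyMap fun p => β (f p) (g p) := by
  intro θ
  let b := Module.finBasis ℂ E
  have : (fun p => θ (β (f p) (g p))) =
      ∑ i, (fun p => b.coord i (f p)) * fun p => (θ ∘ₗ β (b i)) (g p) := by
    ext p
    conv_lhs => rw [← b.sum_repr (f p)]
    simp only [map_sum, map_smul, LinearMap.sum_apply, LinearMap.smul_apply, smul_eq_mul,
      Finset.sum_apply, Pi.mul_apply, Module.Basis.coord_apply, LinearMap.comp_apply]
  rw [this]
  exact sum_mem fun i _ => mul_mem (hf _) (hg _)

theorem IsPolyMap.subtype {S : Submodule ℂ W} {f : P → S}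
    (hf : IsPolyMap fun p => (f p : W)) : IsPolyMap f := by
  intro θ
  obtain ⟨θ', rfl⟩ := LinearMap.exists_extend θ
  exact hf θ'

/-- Pull-back of polynomial functions along a polynomial map. -/
def IsPolyMap.comap {f : P → W} (hf : IsPolyMap f) : polyFun W →ₐ[ℂ] polyFun P :=
  AlgHom.codRestrict
    ({ toFun := fun h p => (h : W → ℂ) (f p)
       map_one' := rfl
       map_mul' := fun _ _ => rfl
       map_zero' := rfl
       map_add' := fun _ _ => rfl
       commutes' := fun _ => rfl } : polyFun W →ₐ[ℂ] P → ℂ) (polyFun P) (by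
    rintro ⟨h, hh⟩
    change (fun p => h (f p)) ∈ polyFun P
    induction hh using Algebra.adjoin_induction with
    | mem x hx => obtain ⟨θ, rfl⟩ := hx; exact hf θ
    | algebraMap r => exact (polyFun P).algebraMap_mem r
    | add x y _ _ hx hy => exact add_mem hx hy
    | mul x y _ _ hx hy => exact mul_mem hx hy)

@[simp] theorem IsPolyMap.comap_apply {f : P → W} (hf : IsPolyMap f) (h : polyFun W) (p : P) :
    (hf.comap h : P → ℂ) p = (h : W → ℂ) (f p) := rfl

end PolynomialMaps

/-! ### Symmetric tensors and their contractions. -/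

section SymmetricTensors

variable {U V : Type*} [AddCommGroup U] [Module ℂ U] [AddCommGroup V] [Module ℂ V]

/-- The third tensor power of a linear map. -/
def cubeMap (φ : U →ₗ[ℂ] V) : U ⊗[ℂ] (U ⊗[ℂ] U) →ₗ[ℂ] V ⊗[ℂ] (V ⊗[ℂ] V) :=
  TensorProduct.map φ (TensorProduct.map φ φ)

@[simp] theorem cubeMap_tmul (φ : U →ₗ[ℂ] V) (x y z : U) :
    cubeMap φ (x ⊗ₜ (y ⊗ₜ z)) = φ x ⊗ₜ (φ y ⊗ₜ φ z) := rfl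

theorem cubeMap_comp {W : Type*} [AddCommGroup W] [Module ℂ W] (ψ : V →ₗ[ℂ] W) (φ : U →ₗ[ℂ] V)
    (T : U ⊗[ℂ] (U ⊗[ℂ] U)) : cubeMap ψ (cubeMap φ T) = cubeMap (ψ ∘ₗ φ) T := by
  have : cubeMap ψ ∘ₗ cubeMap φ = cubeMap (ψ ∘ₗ φ) := TensorProduct.ext_threefold' (by simp)
  exact LinearMap.congr_fun this T

theorem cubeMap_id (T : U ⊗[ℂ] (U ⊗[ℂ] U)) : cubeMap LinearMap.id T = T := by
  simp [cubeMap]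

theorem cubeMap_mem_symCube (φ : U →ₗ[ℂ] V) {T : U ⊗[ℂ] (U ⊗[ℂ] U)} (hT : T ∈ symCube U) :
    cubeMap φ T ∈ symCube V := by
  have h1 : (TensorProduct.leftComm ℂ V V V).toLinearMap ∘ₗ cubeMap φ =
      cubeMap φ ∘ₗ (TensorProduct.leftComm ℂ U U U).toLinearMap :=
    TensorProduct.ext_threefold' (by simp)
  have h2 : (TensorProduct.comm ℂ V V).toLinearMap.lTensor V ∘ₗ cubeMap φ =
      cubeMap φ ∘ₗ (TensorProduct.comm ℂ U U).toLinearMap.lTensor U :=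
    TensorProduct.ext_threefold' (by simp)
  refine ⟨(LinearMap.congr_fun h1 T).trans (congrArg _ hT.1),
    (LinearMap.congr_fun h2 T).trans (congrArg _ hT.2)⟩

/-- Contraction of a tensor with two linear forms in the first two factors. -/
def slice (α β : Module.Dual ℂ V) : V ⊗[ℂ] (V ⊗[ℂ] V) →ₗ[ℂ] V :=
  (TensorProduct.lid ℂ V).toLinearMap ∘ₗ TensorProduct.map α
    ((TensorProduct.lid ℂ V).toLinearMap ∘ₗ TensorProduct.map β LinearMap.id)

@[simp] theorem slice_tmul (α β : Module.Dual ℂ V) (x y z : V) :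
    slice α β (x ⊗ₜ (y ⊗ₜ z)) = α x • β y • z := by
  simp [slice, smul_comm (α x)]

theorem mu_eq_slice (B : LinearMap.BilinForm ℂ V) (T : V ⊗[ℂ] (V ⊗[ℂ] V)) (x y : V) :
    mu B T x y = slice (B x) (B y) T := rfl

theorem slice_cubeMap (φ : U →ₗ[ℂ] V) (α β : Module.Dual ℂ V) (T : U ⊗[ℂ] (U ⊗[ℂ] U)) :
    slice α β (cubeMap φ T) = φ (slice (α ∘ₗ φ) (β ∘ₗ φ) T) := by
  have : slice α β ∘ₗ cubeMap φ = φ ∘ₗ slice (α ∘ₗ φ) (β ∘ₗ φ) :=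
    TensorProduct.ext_threefold' (by simp)
  exact LinearMap.congr_fun this T

theorem eq_zero_of_slice_eq_zero [FiniteDimensional ℂ V] {T : V ⊗[ℂ] (V ⊗[ℂ] V)}
    (h : ∀ α β, slice α β T = 0) : T = 0 := by
  let b := Module.finBasis ℂ V
  refine (b.tensorProduct (b.tensorProduct b)).ext_elem ?_
  rintro ⟨i, j, k⟩
  have : (b.tensorProduct (b.tensorProduct b)).coord (i, j, k) =
      b.coord k ∘ₗ slice (b.coord i) (b.coord j) :=
    TensorProduct.ext_threefold' (by simp [mul_comm])
  have h1 := LinearMap.congr_fun this T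
  simpa [h] using h1

theorem mem_symCubeOf_iff {S : Submodule ℂ V} {T : symCube V} :
    T ∈ symCubeOf S ↔ ∃ c ∈ symCube S, cubeMap S.subtype c = T := Iff.rfl

theorem exists_eq_cubeMap (φ : U →ₗ[ℂ] V) {S : Submodule ℂ V}
    (hS : S ≤ LinearMap.range φ) {T : symCube V} (hT : T ∈ symCubeOf S) :
    ∃ c ∈ symCube U, cubeMap φ c = T := by
  obtain ⟨c, hc, hcT⟩ := mem_symCubeOf_iff.1 hT
  obtain ⟨s, hs⟩ := φ.rangeRestrict.exists_rightInverse_of_surjective φ.range_rangeRestrict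
  have h : φ ∘ₗ (s ∘ₗ Submodule.inclusion hS) = S.subtype := by
    ext x
    exact congrArg Subtype.val (LinearMap.congr_fun hs (Submodule.inclusion hS x))
  exact ⟨cubeMap (s ∘ₗ Submodule.inclusion hS) c, cubeMap_mem_symCube _ hc, by
    rw [cubeMap_comp, h, hcT]⟩

theorem mem_symCubeOf_range (φ : U →ₗ[ℂ] V) {T : symCube V} {c : U ⊗[ℂ] (U ⊗[ℂ] U)}
    (hc : c ∈ symCube U) (h : cubeMap φ c = T) : T ∈ symCubeOf (LinearMap.range φ) :=
  mem_symCubeOf_iff.2 ⟨cubeMap φ.rangeRestrict c, cubeMap_mem_symCube _ hc, by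
    rw [cubeMap_comp, ← h]; rfl⟩

theorem slice_mem {S : Submodule ℂ V} {T : symCube V} (hT : T ∈ symCubeOf S)
    (α β : Module.Dual ℂ V) : slice α β (T : V ⊗[ℂ] (V ⊗[ℂ] V)) ∈ S := by
  obtain ⟨c, -, hc⟩ := mem_symCubeOf_iff.1 hT
  rw [← hc, slice_cubeMap]
  exact Subtype.property _

/-- A projection p onto S applied to the third factor fixes T, because it fixes all contractions. By
symmetry the same holds in the other two factors, so p ⊗ p ⊗ p fixes T. -/
theorem mem_symCubeOf_of_slice_mem [FiniteDimensional ℂ V] {S : Submodule ℂ V} {T : symCube V}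
    (h : ∀ α β, slice α β (T : V ⊗[ℂ] (V ⊗[ℂ] V)) ∈ S) : T ∈ symCubeOf S := by
  obtain ⟨q, hq⟩ := S.subtype.exists_leftInverse_of_injective S.ker_subtype
  obtain ⟨T, hT⟩ := T
  let p : V →ₗ[ℂ] V := S.subtype ∘ₗ q
  have hp : ∀ v ∈ S, p v = v := fun v hv =>
    congrArg Subtype.val (LinearMap.congr_fun hq ⟨v, hv⟩)
  let σ := (TensorProduct.leftComm ℂ V V V).toLinearMap
  let τ := (TensorProduct.comm ℂ V V).toLinearMap.lTensor V
  let P₃ : V ⊗[ℂ] (V ⊗[ℂ] V) →ₗ[ℂ] V ⊗[ℂ] (V ⊗[ℂ] V) := (p.lTensor V).lTensor V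
  have h3 : P₃ T = T := by
    rw [← sub_eq_zero]
    refine eq_zero_of_slice_eq_zero fun α β => ?_
    have : slice α β ∘ₗ P₃ = p ∘ₗ slice α β := TensorProduct.ext_threefold' (by simp [P₃])
    rw [map_sub, sub_eq_zero]
    exact (LinearMap.congr_fun this T).trans (hp _ (h α β))
  -- Conjugating `P₃` by the transpositions moves p to the second and then to the first factor.
  have hστ : cubeMap p = (σ ∘ₗ τ ∘ₗ P₃ ∘ₗ τ ∘ₗ σ) ∘ₗ (τ ∘ₗ P₃ ∘ₗ τ) ∘ₗ P₃ :=
    TensorProduct.ext_threefold' (by simp [σ, τ, P₃])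
  have hσ : σ T = T := hT.1
  have hτ : τ T = T := hT.2
  refine mem_symCubeOf_iff.2 ⟨cubeMap q T, cubeMap_mem_symCube _ hT, ?_⟩
  rw [cubeMap_comp]
  change cubeMap p T = T
  rw [hστ]
  simp only [LinearMap.comp_apply, h3, hσ, hτ]

end SymmetricTensors

/-! ### Associativity and the equations of Z(V). -/

section IsotropicTensors

variable {V : Type*} [AddCommGroup V] [Module ℂ V]
  {B : LinearMap.BilinForm ℂ V}

theorem mu_eq_zero_left {U : Submodule ℂ V} (hU : IsIsotropic B U) {T : symCube V}
    (hT : T ∈ symCubeOf U) {x : V} (hx : x ∈ U) (y : V) : mu B T x y = 0 := by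
  obtain ⟨c, -, hc⟩ := mem_symCubeOf_iff.1 hT
  have h : B x ∘ₗ U.subtype = 0 := by
    ext u
    exact hU x hx u u.2
  rw [← hc, mu_eq_slice, slice_cubeMap, h]
  simp [slice]

theorem mu_eq_zero_right {U : Submodule ℂ V} (hU : IsIsotropic B U) {T : symCube V}
    (hT : T ∈ symCubeOf U) (x : V) {y : V} (hy : y ∈ U) : mu B T x y = 0 := by
  obtain ⟨c, -, hc⟩ := mem_symCubeOf_iff.1 hT
  have h : B y ∘ₗ U.subtype = 0 := by
    ext u
    exact hU y hy u u.2
  rw [← hc, mu_eq_slice, slice_cubeMap, h]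
  simp [slice]

theorem varZ_subset_varX : varZ B ⊆ varX B := by
  rintro T ⟨U, hU, hT⟩ x y z
  exact (mu_eq_zero_right hU.prop hT x (slice_mem hT (B y) (B z))).trans
    (mu_eq_zero_left hU.prop hT (slice_mem hT (B x) (B y)) z).symm

variable [FiniteDimensional ℂ V]

theorem varZ_eq : varZ B = {T | ∃ U : Submodule ℂ V, IsIsotropic B U ∧ T ∈ symCubeOf U} := by
  ext T
  refine ⟨fun ⟨U, hU, hT⟩ => ⟨U, hU.prop, hT⟩, fun ⟨U, hU, hT⟩ => ?_⟩
  obtain ⟨U', hle, hU'⟩ := exists_maximal_ge_of_wellFoundedGT (IsIsotropic B) U hU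
  obtain ⟨c, hc, h⟩ := exists_eq_cubeMap U'.subtype (by simpa using hle) hT
  exact ⟨U', hU', mem_symCubeOf_iff.2 ⟨c, hc, h⟩⟩

/-- The span of all products is the smallest candidate for U, and it is isotropic iff products are
pairwise orthogonal. -/
theorem mem_varZ_iff (hB : B.Nondegenerate) {T : symCube V} :
    T ∈ varZ B ↔ ∀ x y z w, B (mu B T x y) (mu B T z w) = 0 := by
  rw [varZ_eq]
  refine ⟨fun ⟨U, hU, hT⟩ x y z w => hU _ (slice_mem hT _ _) _ (slice_mem hT _ _), fun h => ?_⟩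
  refine ⟨Submodule.span ℂ {v | ∃ x y, mu B T x y = v}, ?_, ?_⟩
  · intro u hu v hv
    induction hu, hv using Submodule.span_induction₂ with
    | mem_mem a b ha hb =>
      obtain ⟨x, y, rfl⟩ := ha
      obtain ⟨z, w, rfl⟩ := hb
      exact h x y z w
    | zero_left => simp
    | zero_right => simp
    | add_left _ _ _ _ _ _ h1 h2 => simp [h1, h2]
    | add_right _ _ _ _ _ _ h1 h2 => simp [h1, h2]
    | smul_left _ _ _ _ _ h1 => simp [h1]
    | smul_right _ _ _ _ _ h1 => simp [h1]
  · refine mem_symCubeOf_of_slice_mem fun α β => Submodule.subset_span ?_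
    obtain ⟨x, rfl⟩ := (B.toDual hB).surjective α
    obtain ⟨y, rfl⟩ := (B.toDual hB).surjective β
    exact ⟨x, y, rfl⟩

theorem isZariskiClosed_varZ (hB : B.Nondegenerate) : IsZariskiClosed (varZ B) := by
  let m (x y : V) : symCube V →ₗ[ℂ] V := slice (B x) (B y) ∘ₗ (symCube V).subtype
  have hf (x y z w : V) : (fun T => B (m x y T) (m z w T)) ∈ polyFun (symCube V) :=
    (isPolyMap_linear (m x y)).bilinear (isPolyMap_linear (m z w)) B LinearMap.id
  refine ⟨Set.range fun q : V × V × V × V => ⟨_, hf q.1 q.2.1 q.2.2.1 q.2.2.2⟩, ?_⟩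
  ext T
  rw [mem_varZ_iff hB]
  simp only [Set.mem_ofPred_eq, Set.forall_mem_range, Prod.forall]
  rfl

end IsotropicTensors

open Matrix

/-! ### Normal form of the quadratic space and charts for isotropic subspaces. -/

section Hyperbolic

variable {m : ℕ} {κ : Type*} [Fintype κ]

/-- The sum of `m` hyperbolic planes and of a space with orthonormal basis `κ`. -/
abbrev HypSpace (m : ℕ) (κ : Type*) : Type _ := (Fin m → ℂ) × (Fin m → ℂ) × (κ → ℂ)

/-- The standard symmetric bilinear form on `HypSpace m κ`. -/
def hyp : LinearMap.BilinForm ℂ (HypSpace m κ) :=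
  LinearMap.mk₂ ℂ (fun x y => x.1 ⬝ᵥ y.2.1 + x.2.1 ⬝ᵥ y.1 + x.2.2 ⬝ᵥ y.2.2)
    (fun x x' y => by simp [add_dotProduct]; ring)
    (fun a x y => by simp [smul_dotProduct]; ring)
    (fun x y y' => by simp [dotProduct_add]; ring)
    (fun a x y => by simp [dotProduct_smul]; ring)

theorem hyp_apply (x y : HypSpace m κ) :
    hyp x y = x.1 ⬝ᵥ y.2.1 + x.2.1 ⬝ᵥ y.1 + x.2.2 ⬝ᵥ y.2.2 := rfl

theorem hyp_comm (x y : HypSpace m κ) : hyp x y = hyp y x := by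
  rw [hyp_apply, hyp_apply, dotProduct_comm x.1, dotProduct_comm x.2.1, dotProduct_comm x.2.2,
    add_comm (y.2.1 ⬝ᵥ x.1)]

theorem hyp_separating {x : HypSpace m κ} (h : ∀ y, hyp x y = 0) : x = 0 := by
  classical
  refine Prod.ext ?_ (Prod.ext ?_ ?_)
  · ext i
    simpa [hyp_apply] using h (0, Pi.single i 1, 0)
  · ext i
    simpa [hyp_apply] using h (Pi.single i 1, 0, 0)
  · ext i
    simpa [hyp_apply] using h (0, 0, Pi.single i 1)

/-- The isometry of `HypSpace m κ` that interchanges the two isotropic basis vectors of the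
hyperbolic planes with index in `I`. -/
def hypSwap (κ : Type*) (I : Finset (Fin m)) : HypSpace m κ ≃ₗ[ℂ] HypSpace m κ :=
  LinearEquiv.ofInvolutive
    { toFun := fun x =>
        (fun i => if i ∈ I then x.2.1 i else x.1 i, fun i => if i ∈ I then x.1 i else x.2.1 i, x.2.2)
      map_add' := fun x y => by
        refine Prod.ext ?_ (Prod.ext ?_ rfl) <;> ext i <;> by_cases h : i ∈ I <;> simp [h]
      map_smul' := fun a x => by
        refine Prod.ext ?_ (Prod.ext ?_ rfl) <;> ext i <;> by_cases h : i ∈ I <;> simp [h] }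
    (fun x => by
        refine Prod.ext ?_ (Prod.ext ?_ rfl) <;> ext i <;> by_cases h : i ∈ I <;> simp [h])

omit [Fintype κ] in
theorem hypSwap_apply (I : Finset (Fin m)) (x : HypSpace m κ) : hypSwap κ I x =
    (fun i => if i ∈ I then x.2.1 i else x.1 i, fun i => if i ∈ I then x.1 i else x.2.1 i, x.2.2) :=
  rfl

theorem hyp_hypSwap (I : Finset (Fin m)) (x y : HypSpace m κ) :
    hyp (hypSwap κ I x) (hypSwap κ I y) = hyp x y := by
  simp only [hyp_apply, hypSwap_apply, dotProduct, ← Finset.sum_add_distrib]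
  congr 1
  refine Finset.sum_congr rfl fun i _ => ?_
  by_cases h : i ∈ I <;> simp [h, add_comm]

variable {V : Type*} [AddCommGroup V] [Module ℂ V]

/-- Nondegenerate complex quadratic forms of equal dimension are equivalent, and polarization
recovers the bilinear forms. -/
theorem exists_isometry_hypSpace [FiniteDimensional ℂ V] {B : LinearMap.BilinForm ℂ V}
    (hs : B.IsSymm) (hB : B.Nondegenerate)
    (hdim : Module.finrank ℂ V = m + m + Fintype.card κ) :
    ∃ Φ : V ≃ₗ[ℂ] HypSpace m κ, ∀ x y, B x y = hyp (Φ x) (Φ y) := by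
  let e : V ≃ₗ[ℂ] HypSpace m κ := LinearEquiv.ofFinrankEq _ _ (by simp [hdim, add_assoc])
  let B₂ : LinearMap.BilinForm ℂ V := hyp.compl₁₂ e.toLinearMap e.toLinearMap
  have hB₂ (x y : V) : B₂ x y = hyp (e x) (e y) := rfl
  have hs₂ : B₂.IsSymm := ⟨fun x y => hyp_comm _ _⟩
  have ha₁ : QuadraticMap.associated (R := ℂ) (LinearMap.BilinMap.toQuadraticMap B) = B :=
    QuadraticMap.associated_left_inverse _ hs.eq
  have ha₂ : QuadraticMap.associated (R := ℂ) (LinearMap.BilinMap.toQuadraticMap B₂) = B₂ :=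
    QuadraticMap.associated_left_inverse _ hs₂.eq
  obtain ⟨f⟩ := QuadraticForm.equivalent_of_isAlgClosed
    (LinearMap.BilinMap.toQuadraticMap B) (LinearMap.BilinMap.toQuadraticMap B₂)
    (by rw [ha₁]; exact hB.1)
    (by
      rw [ha₂]
      intro x hx
      refine e.map_eq_zero_iff.1 (hyp_separating fun y => ?_)
      simpa [hB₂] using hx (e.symm y))
  have hf : ∀ x, hyp (e (f x)) (e (f x)) = B x x := fun x => f.map_app x
  refine ⟨f.toLinearEquiv.trans e, fun x y => ?_⟩
  change B x y = hyp (e (f x)) (e (f y))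
  have h1 := hf (x + y)
  have hadd : f (x + y) = f x + f y := f.toLinearEquiv.map_add x y
  rw [hadd] at h1
  simp only [map_add, LinearMap.add_apply, hf, hyp_comm (e (f y)) (e (f x))] at h1
  have h2 : B y x = B x y := hs.eq y x
  rw [h2] at h1
  linear_combination (-1 / 2) * h1

/-- Choose I so that the classes of the e_i, i ∈ I, form a basis modulo K. The span of these e_i is
then a complement of K: a vector orthogonal to both is 0, and the two meet in 0. -/
theorem exists_coordinate_complement (K : Submodule ℂ (Fin m → ℂ)) :
    ∃ I : Finset (Fin m),
      (∀ b : Fin m → ℂ, (∀ k ∈ K, b ⬝ᵥ k = 0) → (∀ i ∈ I, b i = 0) → b = 0) ∧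
      ∀ k ∈ K, (∀ i ∉ I, k i = 0) → k = 0 := by
  classical
  let v : Fin m → (Fin m → ℂ) ⧸ K := fun i => K.mkQ (Pi.single i 1)
  obtain ⟨I, -, -, hspan, hind⟩ :=
    exists_linearIndepOn_extension (K := ℂ) (v := v) (s := ∅) (t := Set.univ)
      (by simp) (Set.subset_univ _)
  refine ⟨I.toFinset, fun b hb hbI => ?_, fun k hk hkI => ?_⟩
  · have key : ∀ w : Fin m → ℂ, b ⬝ᵥ w = 0 := by
      have hle : ∀ q ∈ Submodule.span ℂ (v '' I), ∀ w, K.mkQ w = q → b ⬝ᵥ w = 0 := by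
        intro q hq
        induction hq using Submodule.span_induction with
        | mem q hq =>
          obtain ⟨i, hi, rfl⟩ := hq
          intro w hw
          have h1 := hb _ ((Submodule.Quotient.eq K).1 hw)
          rw [dotProduct_sub, sub_eq_zero] at h1
          rw [h1]
          simpa using hbI i (by simpa using hi)
        | zero => exact fun w hw => hb w ((Submodule.Quotient.mk_eq_zero K).1 hw)
        | add p q _ _ hp hq =>
          intro w hw
          obtain ⟨p', rfl⟩ := K.mkQ_surjective p
          have := hq (w - p') (by rw [map_sub, hw]; abel)
          rw [dotProduct_sub, hp p' rfl, sub_zero] at this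
          exact this
        | smul a q _ hq =>
          intro w hw
          obtain ⟨q', rfl⟩ := K.mkQ_surjective q
          have h1 := hb (w - a • q') ((Submodule.Quotient.eq K).1 hw)
          rwa [dotProduct_sub, dotProduct_smul, hq q' rfl, smul_zero, sub_zero] at h1
      have htop : ∀ w : Fin m → ℂ, K.mkQ w ∈ Submodule.span ℂ (v '' I) := by
        intro w
        rw [pi_eq_sum_univ' w, map_sum]
        refine sum_mem fun i _ => ?_
        rw [map_smul]
        refine Submodule.smul_mem _ _ (hspan ⟨i, trivial, ?_⟩)
        simp only [v]
      exact fun w => hle _ (htop w) w rfl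
    ext i
    simpa using key (Pi.single i 1)
  · have h0 : ∑ i ∈ I.toFinset, k i • v i = 0 := by
      have : ∑ i ∈ I.toFinset, k i • v i = K.mkQ k := by
        conv_rhs => rw [pi_eq_sum_univ' k, map_sum]
        rw [← Finset.sum_subset (Finset.subset_univ I.toFinset)]
        · refine Finset.sum_congr rfl fun i _ => ?_
          rw [map_smul]
        · intro i _ hi
          rw [hkI i hi, zero_smul, map_zero]
      rw [this]
      exact (Submodule.Quotient.mk_eq_zero K).2 hk
    ext i
    by_cases hi : i ∈ I.toFinset
    · exact linearIndepOn_finset_iff.1 (by simpa using hind) k h0 i hi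
    · exact hkI i hi

/-- Take the complement I for K, the part of U inside the first component. If the swapped first
component of x vanishes, then x.2.1 vanishes on I and is orthogonal to K by isotropy, so it is 0;
then x.2.2 is 0, and x.1 lies in K and in the complement. -/
theorem exists_hypSwap_injOn [Subsingleton κ] (U : Submodule ℂ (HypSpace m κ))
    (hU : IsIsotropic hyp U) :
    ∃ I : Finset (Fin m), ∀ x ∈ U, (hypSwap κ I x).1 = 0 → x = 0 := by
  obtain ⟨I, h1, h2⟩ := exists_coordinate_complement
    (U.comap (LinearMap.inl ℂ (Fin m → ℂ) ((Fin m → ℂ) × (κ → ℂ))))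
  refine ⟨I, fun x hx h0 => ?_⟩
  have h0' (i : Fin m) : (if i ∈ I then x.2.1 i else x.1 i) = 0 := congrFun h0 i
  have hf : x.2.1 = 0 := by
    refine h1 _ (fun k hk => ?_) fun i hi => by simpa [hi] using h0' i
    simpa [hyp_apply] using hU x hx _ hk
  have hg : x.2.2 = 0 := by
    ext c
    -- With at most one anisotropic coordinate, (x|x) = 0 says that its square is 0.
    have h3 := hU x hx x hx
    rw [hyp_apply, hf] at h3
    have : x.2.2 ⬝ᵥ x.2.2 = x.2.2 c * x.2.2 c :=
      Fintype.sum_eq_single c fun d hd => absurd (Subsingleton.elim d c) hd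
    rw [this] at h3
    simpa using h3
  have he : x.1 = 0 := by
    refine h2 _ ?_ fun i hi => by simpa [hi] using h0' i
    have : x = (x.1, 0, 0) := Prod.ext rfl (Prod.ext hf hg)
    rw [this] at hx
    exact hx
  exact Prod.ext he (Prod.ext hf hg)

/-- The index set of the entries of a matrix above the diagonal. -/
abbrev UpperPairs (m : ℕ) : Type := {p : Fin m × Fin m // p.1 < p.2}

/-- The skew-symmetric matrix with given entries above the diagonal. -/
def skewMatrix : (UpperPairs m → ℂ) →ₗ[ℂ] Matrix (Fin m) (Fin m) ℂ where
  toFun s := Matrix.of fun i j =>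
    if h : i < j then s ⟨(i, j), h⟩ else if h : j < i then -s ⟨(j, i), h⟩ else 0
  map_add' s t := by
    ext i j
    rcases lt_trichotomy i j with h | rfl | h
    · simp [h]
    · simp
    · simp [h, h.not_gt, add_comm]
  map_smul' a s := by
    ext i j
    rcases lt_trichotomy i j with h | rfl | h
    · simp [h]
    · simp
    · simp [h, h.not_gt]

theorem skewMatrix_apply_pair (s : UpperPairs m → ℂ) (p : UpperPairs m) :
    skewMatrix s p.1.1 p.1.2 = s p := by
  simp [skewMatrix, p.2]

theorem transpose_skewMatrix (s : UpperPairs m → ℂ) : (skewMatrix s)ᵀ = -skewMatrix s := by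
  ext i j
  rcases lt_trichotomy i j with h | rfl | h
  · simp [skewMatrix, h, h.not_gt]
  · simp [skewMatrix]
  · simp [skewMatrix, h, h.not_gt]

theorem exists_eq_skewMatrix {S : Matrix (Fin m) (Fin m) ℂ} (hS : S + Sᵀ = 0) :
    ∃ s, skewMatrix s = S := by
  refine ⟨fun p => S p.1.1 p.1.2, ?_⟩
  have h (i j : Fin m) : S i j + S j i = 0 := congrFun (congrFun hS i) j
  ext i j
  rcases lt_trichotomy i j with hij | rfl | hij
  · simp [skewMatrix, hij]
  · simp only [skewMatrix, LinearMap.coe_mk, AddHom.coe_mk, of_apply, lt_irrefl, dite_false]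
    linear_combination (-1 / 2) * h i i
  · simp only [skewMatrix, LinearMap.coe_mk, AddHom.coe_mk, of_apply, hij, hij.not_gt, dite_false,
      dite_true]
    linear_combination -h i j

/-- The matrix of the second component of a parametrization of an isotropic subspace. -/
def graphMatrix (s : UpperPairs m → ℂ) (L : Matrix κ (Fin m) ℂ) : Matrix (Fin m) (Fin m) ℂ :=
  skewMatrix s - (1 / 2 : ℂ) • (Lᵀ * L)

/-- A linear parametrization of an isotropic subspace that projects isomorphically to the first
component. -/
def graphMap (s : UpperPairs m → ℂ) (L : Matrix κ (Fin m) ℂ) : (Fin m → ℂ) →ₗ[ℂ] HypSpace m κ :=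
  LinearMap.id.prod ((graphMatrix s L).mulVecLin.prod L.mulVecLin)

theorem graphMap_apply (s : UpperPairs m → ℂ) (L : Matrix κ (Fin m) ℂ) (x : Fin m → ℂ) :
    graphMap s L x = (x, graphMatrix s L *ᵥ x, L *ᵥ x) := rfl

theorem isIsotropic_range_graphMap (s : UpperPairs m → ℂ) (L : Matrix κ (Fin m) ℂ) :
    IsIsotropic hyp (LinearMap.range (graphMap s L)) := by
  rintro _ ⟨x, rfl⟩ _ ⟨y, rfl⟩
  have h : graphMatrix s L + (graphMatrix s L)ᵀ + Lᵀ * L = 0 := by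
    rw [graphMatrix, transpose_sub, transpose_smul, transpose_mul, transpose_transpose,
      transpose_skewMatrix]
    module
  have h1 : graphMatrix s L *ᵥ x ⬝ᵥ y = x ⬝ᵥ (graphMatrix s L)ᵀ *ᵥ y := by
    rw [dotProduct_mulVec, vecMul_transpose]
  have h2 : L *ᵥ x ⬝ᵥ L *ᵥ y = x ⬝ᵥ (Lᵀ * L) *ᵥ y := by
    rw [← mulVec_mulVec, dotProduct_mulVec x, vecMul_transpose]
  rw [hyp_apply, graphMap_apply, graphMap_apply, h1, h2, ← dotProduct_add, ← dotProduct_add,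
    ← add_mulVec, ← add_mulVec, h, zero_mulVec, dotProduct_zero]

/-- U need not project onto ℂ^m, so its graph must be extended to all of ℂ^m compatibly with
isotropy; a left inverse r of the projection supplies matrices M, N, L on the whole space. -/
theorem exists_le_range_graphMap [DecidableEq κ] (U : Submodule ℂ (HypSpace m κ))
    (hU : IsIsotropic hyp U)
    (hinj : ∀ x ∈ U, x.1 = 0 → x = 0) :
    ∃ s L, U ≤ LinearMap.range (graphMap (m := m) (κ := κ) s L) := by
  let π : U →ₗ[ℂ] Fin m → ℂ := LinearMap.fst ℂ _ _ ∘ₗ U.subtype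
  let ρ : U →ₗ[ℂ] Fin m → ℂ := LinearMap.fst ℂ _ _ ∘ₗ LinearMap.snd ℂ _ _ ∘ₗ U.subtype
  let γ : U →ₗ[ℂ] κ → ℂ := LinearMap.snd ℂ _ _ ∘ₗ LinearMap.snd ℂ _ _ ∘ₗ U.subtype
  obtain ⟨r, hr⟩ := π.exists_leftInverse_of_injective
    (LinearMap.ker_eq_bot'.2 fun u hu => Subtype.ext (hinj u u.2 hu))
  have hr' (u : U) : r (π u) = u := LinearMap.congr_fun hr u
  let M := LinearMap.toMatrix' (π ∘ₗ r)
  let N := LinearMap.toMatrix' (ρ ∘ₗ r)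
  let L := LinearMap.toMatrix' (γ ∘ₗ r)
  have hM (x) : M *ᵥ x = π (r x) := LinearMap.toMatrix'_mulVec _ _
  have hN (x) : N *ᵥ x = ρ (r x) := LinearMap.toMatrix'_mulVec _ _
  have hL (x) : L *ᵥ x = γ (r x) := LinearMap.toMatrix'_mulVec _ _
  have hiso : Mᵀ * N + Nᵀ * M + Lᵀ * L = 0 := by
    refine ext_of_mulVec_single fun j => ?_
    refine dotProduct_eq _ _ fun x => ?_
    have h := hU _ (r x).2 _ (r (Pi.single j 1)).2
    rw [hyp_apply] at h
    change π (r x) ⬝ᵥ ρ (r _) + ρ (r x) ⬝ᵥ π (r _) + γ (r x) ⬝ᵥ γ (r _) = 0 at h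
    simp only [← hM, ← hN, ← hL] at h
    rw [dotProduct_comm, zero_mulVec, zero_dotProduct, add_mulVec, add_mulVec, dotProduct_add,
      dotProduct_add, ← mulVec_mulVec, ← mulVec_mulVec, ← mulVec_mulVec, dotProduct_mulVec x,
      dotProduct_mulVec x, dotProduct_mulVec x, vecMul_transpose, vecMul_transpose,
      vecMul_transpose]
    exact h
  -- This makes G = N − Nᵀ + NᵀM. On the projection of U, M is the identity, so G agrees with N
  -- there; the term −Nᵀ + NᵀM makes the skewness condition exactly `hiso`.
  obtain ⟨s, hs⟩ := exists_eq_skewMatrix (S := N - Nᵀ + Nᵀ * M + (1 / 2 : ℂ) • (Lᵀ * L)) (by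
    rw [← hiso]
    simp only [transpose_add, transpose_sub, transpose_smul, transpose_mul, transpose_transpose]
    module)
  refine ⟨s, L, fun u hu => ⟨u.1, ?_⟩⟩
  have hu' : r u.1 = ⟨u, hu⟩ := hr' ⟨u, hu⟩
  rw [graphMap_apply, graphMatrix, hs, add_sub_cancel_right, add_mulVec, sub_mulVec,
    ← mulVec_mulVec, hM, hN, hL, hu']
  change (u.1, u.2.1 - Nᵀ *ᵥ u.1 + Nᵀ *ᵥ u.1, u.2.2) = u
  rw [sub_add_cancel]

end Hyperbolic

/-! ### Counting coordinates of skew matrices and symmetric tensors. -/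

section Dimensions

theorem card_upperPairs (m : ℕ) : Fintype.card (UpperPairs m) = m.choose 2 := by
  rw [Fintype.card_subtype, Finset.card_filter, Fintype.sum_prod_type_right]
  simp only [← Finset.card_filter]
  have (j : Fin m) : (Finset.univ.filter fun i => i < j).card = (j : ℕ) := by
    rw [Finset.filter_gt_eq_Iio, Fin.card_Iio]
  simp only [this]
  rw [Fin.sum_univ_eq_sum_range (fun i => i), Finset.sum_range_id, Nat.choose_two_right]

theorem eq_of_triple_eq {α β : Type*} (f : α → α → α → β) (h1 : ∀ i j k, f j i k = f i j k)
    (h2 : ∀ i j k, f i k j = f i j k) {i j k i' j' k' : α}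
    (h : ({i, j, k} : Multiset α) = {i', j', k'}) : f i j k = f i' j' k' := by
  have pair {a b c d e : α} (h : ({b, c} : Multiset α) = {d, e}) : f a b c = f a d e := by
    have hb : b ∈ ({d, e} : Multiset α) := h ▸ Multiset.mem_cons_self _ _
    rcases Multiset.mem_cons.1 hb with rfl | hb
    · obtain rfl := Multiset.singleton_inj.1 ((Multiset.cons_inj_right _).1 h)
      rfl
    · obtain rfl := Multiset.mem_singleton.1 hb
      rw [Multiset.pair_comm d b] at h
      obtain rfl := Multiset.singleton_inj.1 ((Multiset.cons_inj_right _).1 h)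
      exact (h2 _ _ _).symm
  have hi : i ∈ ({i', j', k'} : Multiset α) := h ▸ Multiset.mem_cons_self _ _
  rcases Multiset.mem_cons.1 hi with rfl | hi
  · exact pair ((Multiset.cons_inj_right _).1 h)
  rcases Multiset.mem_cons.1 hi with rfl | hi
  · rw [show ({i', i, k'} : Multiset α) = {i, i', k'} from Multiset.cons_swap _ _ _] at h
    rw [pair ((Multiset.cons_inj_right _).1 h), h1]
  · obtain rfl := Multiset.mem_singleton.1 hi
    rw [show ({i', j', i} : Multiset α) = {i, i', j'} by
      rw [Multiset.pair_comm j' i]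
      exact Multiset.cons_swap i' i {j'}] at h
    rw [pair ((Multiset.cons_inj_right _).1 h), h1, h2]

/-- The basis of `U ⊗ U ⊗ U`, for a coordinate space `U`, given by the basis tensors. -/
def cubeBasis (m : ℕ) : Module.Basis (Fin m × Fin m × Fin m) ℂ
    ((Fin m → ℂ) ⊗[ℂ] ((Fin m → ℂ) ⊗[ℂ] (Fin m → ℂ))) :=
  (Pi.basisFun ℂ (Fin m)).tensorProduct
    ((Pi.basisFun ℂ (Fin m)).tensorProduct (Pi.basisFun ℂ (Fin m)))

theorem cubeBasis_repr_leftComm {m : ℕ} (T) (i j k : Fin m) :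
    (cubeBasis m).repr (TensorProduct.leftComm ℂ _ _ _ T) (i, j, k) =
      (cubeBasis m).repr T (j, i, k) := by
  have : (cubeBasis m).coord (i, j, k) ∘ₗ (TensorProduct.leftComm ℂ _ _ _).toLinearMap =
      (cubeBasis m).coord (j, i, k) :=
    TensorProduct.ext_threefold' (by simp [cubeBasis, mul_right_comm])
  exact LinearMap.congr_fun this T

theorem cubeBasis_repr_lTensor_comm {m : ℕ} (T) (i j k : Fin m) :
    (cubeBasis m).repr ((TensorProduct.comm ℂ _ _).toLinearMap.lTensor _ T) (i, j, k) =
      (cubeBasis m).repr T (i, k, j) := by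
  have : (cubeBasis m).coord (i, j, k) ∘ₗ (TensorProduct.comm ℂ _ _).toLinearMap.lTensor _ =
      (cubeBasis m).coord (i, k, j) :=
    TensorProduct.ext_threefold' (by simp [cubeBasis, mul_comm])
  exact LinearMap.congr_fun this T

theorem mem_symCube_iff {m : ℕ} {T : (Fin m → ℂ) ⊗[ℂ] ((Fin m → ℂ) ⊗[ℂ] (Fin m → ℂ))} :
    T ∈ symCube (Fin m → ℂ) ↔
      (∀ i j k, (cubeBasis m).repr T (j, i, k) = (cubeBasis m).repr T (i, j, k)) ∧
      ∀ i j k, (cubeBasis m).repr T (i, k, j) = (cubeBasis m).repr T (i, j, k) := by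
  refine ⟨fun h => ⟨fun i j k => ?_, fun i j k => ?_⟩, fun h =>
    ⟨(cubeBasis m).ext_elem ?_, (cubeBasis m).ext_elem ?_⟩⟩
  · rw [← cubeBasis_repr_leftComm, h.1]
  · rw [← cubeBasis_repr_lTensor_comm, h.2]
  · rintro ⟨i, j, k⟩
    exact (cubeBasis_repr_leftComm T i j k).trans (h.1 i j k)
  · rintro ⟨i, j, k⟩
    exact (cubeBasis_repr_lTensor_comm T i j k).trans (h.2 i j k)

/-- The coordinates of a symmetric tensor depend only on the multiset of the three indices, so they
are an arbitrary function on `Sym (Fin m) 3`. -/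
theorem exists_linear_range_eq_symCube (m : ℕ) :
    ∃ F : (Sym (Fin m) 3 → ℂ) →ₗ[ℂ] (Fin m → ℂ) ⊗[ℂ] ((Fin m → ℂ) ⊗[ℂ] (Fin m → ℂ)),
      Function.Injective F ∧ LinearMap.range F = symCube (Fin m → ℂ) := by
  let t : Fin m × Fin m × Fin m → Sym (Fin m) 3 := fun q => ⟨{q.1, q.2.1, q.2.2}, rfl⟩
  have ht : Function.Surjective t := by
    rintro ⟨s, hs⟩
    obtain ⟨i, j, k, rfl⟩ := Multiset.card_eq_three.1 hs
    exact ⟨(i, j, k), rfl⟩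
  obtain ⟨F, hF⟩ : ∃ F : (Sym (Fin m) 3 → ℂ) →ₗ[ℂ] _,
      ∀ g q, (cubeBasis m).repr (F g) q = g (t q) :=
    ⟨(cubeBasis m).equivFun.symm.toLinearMap ∘ₗ LinearMap.funLeft ℂ ℂ t, fun g q => by
      rw [← Module.Basis.equivFun_apply, LinearMap.comp_apply, LinearEquiv.coe_coe,
        LinearEquiv.apply_symm_apply, LinearMap.funLeft_apply]⟩
  have hinj : Function.Injective F := fun g g' h => ht.injective_comp_right (funext fun q => by
    change g (t q) = g' (t q)
    rw [← hF g, ← hF g', h])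
  have hrange : LinearMap.range F = symCube (Fin m → ℂ) := by
    refine le_antisymm ?_ fun T hT => ?_
    · rintro _ ⟨g, rfl⟩
      rw [mem_symCube_iff]
      refine ⟨fun i j k => ?_, fun i j k => ?_⟩
      · rw [hF, hF]
        exact congrArg g (Subtype.ext (Multiset.cons_swap j i {k}))
      · rw [hF, hF]
        exact congrArg g (Subtype.ext (congrArg (Multiset.cons i) (Multiset.pair_comm k j)))
    · obtain ⟨h1, h2⟩ := mem_symCube_iff.1 hT
      obtain ⟨r, hr⟩ := ht.hasRightInverse
      have key (q) : (cubeBasis m).repr T (r (t q)) = (cubeBasis m).repr T q := by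
        have hq : (t (r (t q))).1 = (t q).1 := congrArg Subtype.val (hr (t q))
        generalize r (t q) = q' at hq ⊢
        obtain ⟨i, j, k⟩ := q
        obtain ⟨i', j', k'⟩ := q'
        exact eq_of_triple_eq (fun i j k => (cubeBasis m).repr T (i, j, k)) h1 h2 hq
      refine ⟨fun s => (cubeBasis m).repr T (r s), (cubeBasis m).ext_elem fun q => ?_⟩
      rw [hF, key]
  exact ⟨F, hinj, hrange⟩

/-- Coordinates on the space of symmetric tensors on a coordinate space. -/
def symCubeCoord (m : ℕ) :
    (Sym (Fin m) 3 → ℂ) →ₗ[ℂ] (Fin m → ℂ) ⊗[ℂ] ((Fin m → ℂ) ⊗[ℂ] (Fin m → ℂ)) :=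
  (exists_linear_range_eq_symCube m).choose

theorem symCubeCoord_injective (m : ℕ) : Function.Injective (symCubeCoord m) :=
  (exists_linear_range_eq_symCube m).choose_spec.1

theorem range_symCubeCoord (m : ℕ) : LinearMap.range (symCubeCoord m) = symCube (Fin m → ℂ) :=
  (exists_linear_range_eq_symCube m).choose_spec.2

theorem card_sym_three (m : ℕ) : Fintype.card (Sym (Fin m) 3) = (m + 2).choose 3 := by
  rw [Sym.card_sym_eq_choose, Fintype.card_fin]
  rfl

end Dimensions

/-! ### Polynomial charts covering Z(V). -/

section Parametrization

variable {m : ℕ} {κ : Type*} [Fintype κ]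
  {V : Type*} [AddCommGroup V] [Module ℂ V]

/-- The parameter space for symmetric tensors on the isotropic subspaces in a chart. -/
abbrev ParamSpace (m : ℕ) (κ : Type*) : Type _ :=
  (UpperPairs m → ℂ) × Matrix κ (Fin m) ℂ × (Sym (Fin m) 3 → ℂ)

theorem finrank_paramSpace :
    Module.finrank ℂ (ParamSpace m κ) =
      (m + 2).choose 3 + (m.choose 2 + Fintype.card κ * m) := by
  rw [Module.finrank_prod, Module.finrank_prod, Module.finrank_fintype_fun_eq_card,
    Module.finrank_fintype_fun_eq_card, card_upperPairs, Module.finrank_matrix, card_sym_three,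
    Module.finrank_self,
    Fintype.card_fin]
  ring

/-- The embedding of a coordinate space in `V` given by a point of the parameter space. -/
def chartMap (Φ : V ≃ₗ[ℂ] HypSpace m κ) (p : ParamSpace m κ) : (Fin m → ℂ) →ₗ[ℂ] V :=
  Φ.symm.toLinearMap ∘ₗ graphMap p.1 p.2.1

/-- The symmetric tensor on `V` given by a point of the parameter space. -/
def param (Φ : V ≃ₗ[ℂ] HypSpace m κ) (p : ParamSpace m κ) : symCube V :=
  ⟨cubeMap (chartMap Φ p) (symCubeCoord m p.2.2),
    cubeMap_mem_symCube _ (range_symCubeCoord m ▸ ⟨_, rfl⟩)⟩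

theorem IsPolyMap.graphMatrix {P : Type*} [AddCommGroup P] [Module ℂ P]
    {s : P → UpperPairs m → ℂ} {L : P → Matrix κ (Fin m) ℂ} (hs : IsPolyMap s)
    (hL : IsPolyMap L) : IsPolyMap fun p => graphMatrix (s p) (L p) := by
  let β : Matrix κ (Fin m) ℂ →ₗ[ℂ] Matrix κ (Fin m) ℂ →ₗ[ℂ] Matrix (Fin m) (Fin m) ℂ :=
    LinearMap.mk₂ ℂ (fun L L' => Lᵀ * L') (by simp [Matrix.add_mul]) (by simp)
      (by simp [Matrix.mul_add]) (by simp)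
  have h := (hs.linear_comp skewMatrix).add
    ((hL.bilinear hL β).linear_comp ((-(1 / 2) : ℂ) • LinearMap.id))
  have heq : (fun p => Odeco.graphMatrix (s p) (L p)) = fun p => skewMatrix (s p) +
      ((-(1 / 2) : ℂ) • LinearMap.id (R := ℂ)) (β (L p) (L p)) := by
    funext p
    simp [Odeco.graphMatrix, β, sub_eq_add_neg]
  rw [heq]
  exact h

theorem IsPolyMap.graphMap {P : Type*} [AddCommGroup P] [Module ℂ P]
    {s : P → UpperPairs m → ℂ} {L : P → Matrix κ (Fin m) ℂ} (hs : IsPolyMap s)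
    (hL : IsPolyMap L) : IsPolyMap fun p => graphMap (s p) (L p) := by
  let ψ₁ : (Fin m → ℂ) →ₗ[ℂ] HypSpace m κ := LinearMap.inl ℂ _ _
  let ψ₂ : (Fin m → ℂ) →ₗ[ℂ] HypSpace m κ := LinearMap.inr ℂ _ _ ∘ₗ LinearMap.inl ℂ _ _
  let ψ₃ : (κ → ℂ) →ₗ[ℂ] HypSpace m κ := LinearMap.inr ℂ _ _ ∘ₗ LinearMap.inr ℂ _ _
  have h2 := (hs.graphMatrix hL).linear_comp
    (LinearMap.llcomp ℂ _ _ _ ψ₂ ∘ₗ Matrix.toLin'.toLinearMap)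
  have h3 := hL.linear_comp (LinearMap.llcomp ℂ _ _ _ ψ₃ ∘ₗ Matrix.toLin'.toLinearMap)
  have heq : (fun p => Odeco.graphMap (s p) (L p)) = fun p => ψ₁ +
      (LinearMap.llcomp ℂ _ _ _ ψ₂ ∘ₗ Matrix.toLin'.toLinearMap)
        (Odeco.graphMatrix (s p) (L p)) +
      (LinearMap.llcomp ℂ _ _ _ ψ₃ ∘ₗ Matrix.toLin'.toLinearMap) (L p) := by
    funext p
    refine LinearMap.ext fun x => ?_
    simp [graphMap_apply, ψ₁, ψ₂, ψ₃]
  rw [heq]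
  exact ((isPolyMap_const ψ₁).add h2).add h3

theorem IsPolyMap.cubeMap {P U : Type*} [AddCommGroup P] [Module ℂ P] [AddCommGroup U] [Module ℂ U]
    [FiniteDimensional ℂ U] [FiniteDimensional ℂ V] {φ : P → U →ₗ[ℂ] V}
    {c : P → U ⊗[ℂ] (U ⊗[ℂ] U)} (hφ : IsPolyMap φ) (hc : IsPolyMap c) :
    IsPolyMap fun p => cubeMap (φ p) (c p) := by
  have h2 := hφ.bilinear hφ (TensorProduct.mapBilinear (RingHom.id ℂ) _ _ _ _)
  have h3 := hφ.bilinear h2 (TensorProduct.mapBilinear (RingHom.id ℂ) _ _ _ _)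
  exact h3.bilinear hc LinearMap.id

theorem isPolyMap_fst {E F : Type*} [AddCommGroup E] [Module ℂ E] [AddCommGroup F] [Module ℂ F] :
    IsPolyMap fun p : E × F => p.1 := isPolyMap_linear (LinearMap.fst ℂ E F)

theorem isPolyMap_snd {E F : Type*} [AddCommGroup E] [Module ℂ E] [AddCommGroup F] [Module ℂ F] :
    IsPolyMap fun p : E × F => p.2 := isPolyMap_linear (LinearMap.snd ℂ E F)

theorem isPolyMap_param_graphMatrix : IsPolyMap fun p : ParamSpace m κ => graphMatrix p.1 p.2.1 :=
  isPolyMap_fst.graphMatrix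
    (isPolyMap_snd.linear_comp (LinearMap.fst ℂ (Matrix κ (Fin m) ℂ) (Sym (Fin m) 3 → ℂ)))

theorem isPolyMap_param_graphMap : IsPolyMap fun p : ParamSpace m κ => graphMap p.1 p.2.1 :=
  isPolyMap_fst.graphMap
    (isPolyMap_snd.linear_comp (LinearMap.fst ℂ (Matrix κ (Fin m) ℂ) (Sym (Fin m) 3 → ℂ)))

theorem isPolyMap_param [FiniteDimensional ℂ V] (Φ : V ≃ₗ[ℂ] HypSpace m κ) :
    IsPolyMap (param Φ) := by
  have hc : IsPolyMap fun p : ParamSpace m κ => symCubeCoord m p.2.2 :=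
    (isPolyMap_snd.linear_comp (LinearMap.snd ℂ (Matrix κ (Fin m) ℂ) (Sym (Fin m) 3 → ℂ))).linear_comp
      (symCubeCoord m)
  have hφ : IsPolyMap (chartMap Φ) :=
    isPolyMap_param_graphMap.linear_comp (LinearMap.llcomp ℂ _ _ _ Φ.symm.toLinearMap)
  exact IsPolyMap.subtype (hφ.cubeMap hc)

variable {B : LinearMap.BilinForm ℂ V} {Φ : V ≃ₗ[ℂ] HypSpace m κ}

theorem param_mem_varZ [FiniteDimensional ℂ V] (hΦ : ∀ x y, B x y = hyp (Φ x) (Φ y))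
    (p : ParamSpace m κ) : param Φ p ∈ varZ B := by
  rw [varZ_eq]
  refine ⟨_, ?_, mem_symCubeOf_range (chartMap Φ p) (range_symCubeCoord m ▸ ⟨_, rfl⟩) rfl⟩
  rintro _ ⟨x, rfl⟩ _ ⟨y, rfl⟩
  rw [hΦ]
  simpa [chartMap] using isIsotropic_range_graphMap p.1 p.2.1 _ ⟨x, rfl⟩ _ ⟨y, rfl⟩

theorem exists_param_eq [FiniteDimensional ℂ V] [Subsingleton κ]
    (hΦ : ∀ x y, B x y = hyp (Φ x) (Φ y)) {T : symCube V} (hT : T ∈ varZ B) :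
    ∃ (I : Finset (Fin m)) (p : ParamSpace m κ), param (Φ.trans (hypSwap κ I)) p = T := by
  classical
  obtain ⟨U, hU, hTU⟩ := hT
  have hU' : IsIsotropic hyp (U.map Φ.toLinearMap) := by
    rintro _ ⟨x, hx, rfl⟩ _ ⟨y, hy, rfl⟩
    exact (hΦ x y).symm.trans (hU.prop x hx y hy)
  obtain ⟨I, hI⟩ := exists_hypSwap_injOn _ hU'
  obtain ⟨s, L, hle⟩ := exists_le_range_graphMap
    (U.map (Φ.trans (hypSwap κ I)).toLinearMap) (by
      rintro _ ⟨x, hx, rfl⟩ _ ⟨y, hy, rfl⟩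
      exact (hyp_hypSwap I _ _).trans (hU' _ ⟨x, hx, rfl⟩ _ ⟨y, hy, rfl⟩)) (by
      rintro _ ⟨x, hx, rfl⟩ h
      have h0 : Φ x = 0 := hI _ ⟨x, hx, rfl⟩ h
      change hypSwap κ I (Φ x) = 0
      rw [h0, map_zero])
  have hUle : U ≤ LinearMap.range (chartMap (Φ.trans (hypSwap κ I)) (s, L, 0)) := by
    intro u hu
    obtain ⟨x, hx⟩ := hle ⟨u, hu, rfl⟩
    refine ⟨x, ?_⟩
    change (Φ.trans (hypSwap κ I)).symm (graphMap s L x) = u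
    rw [hx]
    exact (Φ.trans (hypSwap κ I)).symm_apply_apply u
  obtain ⟨c, hc, h⟩ := exists_eq_cubeMap _ hUle hTU
  rw [← range_symCubeCoord] at hc
  obtain ⟨g, rfl⟩ := hc
  exact ⟨I, (s, L, g), Subtype.ext h⟩

end Parametrization

/-! ### The dimension of Z(V). -/

section Dimension

variable {m : ℕ} {κ : Type*} [Fintype κ]
  {V : Type*} [AddCommGroup V] [Module ℂ V] [FiniteDimensional ℂ V]
  {B : LinearMap.BilinForm ℂ V} {Φ : V ≃ₗ[ℂ] HypSpace m κ}

/-- More than dim P functions on Z satisfy a nonzero relation on each of the finitely many charts;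
the product of these relations holds on all of Z. -/
theorem affineDim_le_finrank {W P ι : Type*} [AddCommGroup W] [Module ℂ W]
    [FiniteDimensional ℂ W] [AddCommGroup P] [Module ℂ P] [FiniteDimensional ℂ P] [Finite ι]
    {Z : Set W} (hne : Z.Nonempty) {ψ : ι → P → W} (hψ : ∀ i, IsPolyMap (ψ i))
    (hZ : ∀ w ∈ Z, ∃ i p, ψ i p = w) :
    affineDim Z ≤ (Module.finrank ℂ P : ℕ) := by
  have := Fintype.ofFinite ι
  have : Nontrivial (CoordinateRing Z) := Ideal.Quotient.nontrivial_iff.2 fun h => by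
    obtain ⟨w, hw⟩ := hne
    have h1 : (1 : polyFun W) ∈ vanishingIdeal Z := h ▸ Submodule.mem_top
    exact one_ne_zero (h1 w hw)
  refine ringKrullDim_le_of_algebraicIndependent ℂ (CoordinateRing Z) _ fun s x hx => ?_
  by_contra! hs
  choose f hf using fun i => Ideal.Quotient.mk_surjective (x i)
  choose F hF0 hF using fun i => exists_relation_polyFun hs fun j => (hψ i).comap (f j)
  have h0 : MvPolynomial.aeval x (∏ i, F i) = 0 := by
    have hxf : x = fun i => Ideal.Quotient.mkₐ ℂ (vanishingIdeal Z) (f i) :=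
      funext fun i => (hf i).symm
    rw [hxf, ← MvPolynomial.comp_aeval_apply]
    refine Ideal.Quotient.eq_zero_iff_mem.2 fun w hw => ?_
    obtain ⟨i, p, rfl⟩ := hZ w hw
    have h1 : (hψ i).comap (MvPolynomial.aeval f (∏ i, F i)) = 0 := by
      rw [MvPolynomial.comp_aeval_apply, map_prod]
      exact Finset.prod_eq_zero (Finset.mem_univ i) (hF i)
    exact congrFun (congrArg Subtype.val h1) p
  exact Finset.prod_ne_zero_iff.2 (fun i _ => hF0 i)
    ((injective_iff_map_eq_zero _).1 hx _ h0)

theorem isAlgebraic_of_mul_mem {A : Type*} [CommRing A] [IsDomain A] [Algebra ℂ A]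
    {R : Subalgebra ℂ A} {a x : A} (ha : a ∈ R) (ha0 : a ≠ 0) (hx : a * x ∈ R) :
    IsAlgebraic R x := by
  refine ⟨Polynomial.C ⟨a, ha⟩ * Polynomial.X - Polynomial.C ⟨a * x, hx⟩, fun h => ha0 ?_, ?_⟩
  · simpa using congrArg Subtype.val (congrArg (fun q => Polynomial.coeff q 1) h)
  · simp

/-- Cramer's rule: multiply the equation by the adjugate. -/
theorem det_mul_mem {A ι κ : Type*} [CommRing A] [Algebra ℂ A] [Fintype ι] [DecidableEq ι]
    {R : Subalgebra ℂ A} {M : Matrix ι ι A} {X N : Matrix ι κ A} (hM : ∀ i j, M i j ∈ R)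
    (hN : ∀ i j, N i j ∈ R) (h : M * X = N) (i : ι) (j : κ) :
    M.det ∈ R ∧ M.det * X i j ∈ R := by
  let M' : Matrix ι ι R := of fun i j => ⟨M i j, hM i j⟩
  have hM' : M = M'.map R.val := rfl
  have hadj (i j) : M.adjugate i j ∈ R := by
    rw [hM', ← AlgHom.mapMatrix_apply, ← AlgHom.map_adjugate]
    exact Subtype.property _
  constructor
  · rw [hM', ← AlgHom.mapMatrix_apply, ← AlgHom.map_det]
    exact Subtype.property _
  · have h1 : M.adjugate * N = M.det • X := by
      rw [← h, ← Matrix.mul_assoc, adjugate_mul, smul_mul, Matrix.one_mul]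
    have h2 := congrFun (congrFun h1 i) j
    rw [Matrix.smul_apply, smul_eq_mul] at h2
    rw [← h2, mul_apply]
    exact sum_mem fun k _ => mul_mem (hadj _ _) (hN _ _)

theorem isAlgebraic_algebraMap_complex {A : Type*} [CommRing A] [IsDomain A] [Algebra ℂ A]
    (R : Subalgebra ℂ A) (a : ℂ) : IsAlgebraic R (algebraMap ℂ A a) :=
  isAlgebraic_algebraMap (algebraMap ℂ R a)

theorem isAlgebraic_polyFun {P ι : Type*} [AddCommGroup P] [Module ℂ P] [FiniteDimensional ℂ P]
    [Finite ι] (b : Module.Basis ι ℂ P) {R : Subalgebra ℂ (polyFun P)}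
    (h : ∀ i, IsAlgebraic R (polyFunOfDual (b.coord i))) : Algebra.IsAlgebraic R (polyFun P) := by
  refine ⟨fun x => ?_⟩
  obtain ⟨q, rfl⟩ := polyFunOfBasis_surjective b x
  induction q using MvPolynomial.induction_on with
  | C a =>
    rw [polyFunOfBasis, MvPolynomial.aeval_C]
    exact isAlgebraic_algebraMap_complex R a
  | add p q hp hq => rw [map_add]; exact hp.add hq
  | mul_X p i hp =>
    rw [map_mul]
    refine hp.mul ?_
    simpa [polyFunOfBasis] using h i

theorem finrank_le_affineDim {W P : Type*} [AddCommGroup W] [Module ℂ W]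
    [FiniteDimensional ℂ W] [AddCommGroup P] [Module ℂ P] [FiniteDimensional ℂ P]
    {Z : Set W} {ψ : P → W} (hψ : IsPolyMap ψ) (hZ : ∀ p, ψ p ∈ Z)
    (halg : Algebra.IsAlgebraic hψ.comap.range (polyFun P)) :
    (Module.finrank ℂ P : ℕ) ≤ affineDim Z := by
  let f : CoordinateRing Z →ₐ[ℂ] polyFun P :=
    Ideal.Quotient.liftₐ (vanishingIdeal Z) hψ.comap fun g hg =>
      Subtype.ext (funext fun p => hg _ (hZ p))
  have hf : f.range = hψ.comap.range := by
    refine le_antisymm ?_ ?_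
    · rintro _ ⟨x, rfl⟩
      obtain ⟨g, rfl⟩ := Ideal.Quotient.mk_surjective x
      exact ⟨g, rfl⟩
    · rintro _ ⟨g, rfl⟩
      exact ⟨Ideal.Quotient.mk _ g, rfl⟩
  have : Algebra.IsAlgebraic f.range (polyFun P) := by rwa [hf]
  exact trdeg_le_ringKrullDim (R := CoordinateRing Z) (A := polyFun P) ℂ f _ trdeg_polyFun

/-- Coordinates on the parameter space. -/
def paramBasis (m : ℕ) (κ : Type*) [Fintype κ] :
    Module.Basis (UpperPairs m ⊕ (κ × Fin m) ⊕ Sym (Fin m) 3) ℂ (ParamSpace m κ) :=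
  (Pi.basisFun ℂ _).prod ((Matrix.stdBasis ℂ κ (Fin m)).prod (Pi.basisFun ℂ _))

theorem paramBasis_coord_inl (q : UpperPairs m) (p : ParamSpace m κ) :
    (paramBasis m κ).coord (Sum.inl q) p = p.1 q := by
  simp [paramBasis]

theorem paramBasis_coord_inr_inl (c : κ) (i : Fin m) (p : ParamSpace m κ) :
    (paramBasis m κ).coord (Sum.inr (Sum.inl (c, i))) p = p.2.1 c i := by
  simp [paramBasis, Matrix.stdBasis]

theorem paramBasis_coord_inr_inr (t : Sym (Fin m) 3) (p : ParamSpace m κ) :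
    (paramBasis m κ).coord (Sum.inr (Sum.inr t)) p = p.2.2 t := by
  simp [paramBasis]

/-- The coordinates of the contraction of a tensor with twice the same coordinate function. -/
def diagSlice (Φ : V ≃ₗ[ℂ] HypSpace m κ) (i : Fin m) : symCube V →ₗ[ℂ] HypSpace m κ :=
  Φ.toLinearMap ∘ₗ slice (LinearMap.proj i ∘ₗ LinearMap.fst ℂ _ _ ∘ₗ Φ.toLinearMap)
    (LinearMap.proj i ∘ₗ LinearMap.fst ℂ _ _ ∘ₗ Φ.toLinearMap) ∘ₗ (symCube V).subtype

omit [FiniteDimensional ℂ V] in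
theorem fst_comp_chartMap (Φ : V ≃ₗ[ℂ] HypSpace m κ) (p : ParamSpace m κ) :
    (LinearMap.fst ℂ _ _ ∘ₗ Φ.toLinearMap) ∘ₗ chartMap Φ p = LinearMap.id := by
  refine LinearMap.ext fun x => ?_
  simp [chartMap, graphMap_apply]

omit [FiniteDimensional ℂ V] in
theorem diagSlice_param (Φ : V ≃ₗ[ℂ] HypSpace m κ) (i : Fin m) (p : ParamSpace m κ) :
    diagSlice Φ i (param Φ p) = graphMap p.1 p.2.1
      (slice (LinearMap.proj i) (LinearMap.proj i) (symCubeCoord m p.2.2)) := by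
  have h : (LinearMap.proj i ∘ₗ LinearMap.fst ℂ _ _ ∘ₗ Φ.toLinearMap) ∘ₗ chartMap Φ p =
      LinearMap.proj i := by
    rw [LinearMap.comp_assoc, fst_comp_chartMap, LinearMap.comp_id]
  change Φ (slice _ _ (cubeMap (chartMap Φ p) _)) = _
  rw [slice_cubeMap, h]
  exact Φ.apply_symm_apply _

theorem exists_slice_eq_single (m : ℕ) : ∃ g : Sym (Fin m) 3 → ℂ, ∀ i : Fin m,
    slice (LinearMap.proj i) (LinearMap.proj i) (symCubeCoord m g) = Pi.single i 1 := by
  let e : Fin m → Fin m → ℂ := fun i => Pi.single i 1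
  have hmem : ∑ i, e i ⊗ₜ[ℂ] (e i ⊗ₜ[ℂ] e i) ∈ symCube (Fin m → ℂ) :=
    sum_mem fun i _ => ⟨by simp, by simp⟩
  rw [← range_symCubeCoord] at hmem
  obtain ⟨g, hg⟩ := hmem
  refine ⟨g, fun i => ?_⟩
  rw [hg, map_sum]
  simp only [slice_tmul, LinearMap.proj_apply]
  rw [Finset.sum_eq_single i]
  · simp [e]
  · intro j _ hj
    simp [e, hj.symm]
  · simp

theorem polyFun_mul_apply {P ι κ ν : Type*} [AddCommGroup P] [Module ℂ P] [Fintype ι]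
    (M : Matrix κ ι (polyFun P)) (N : Matrix ι ν (polyFun P)) (i : κ) (j : ν) (p : P) :
    ((M * N) i j : P → ℂ) p = ∑ k, (M i k : P → ℂ) p * (N k j : P → ℂ) p := by
  rw [mul_apply]
  simp

/-- The chart can be inverted generically. The rows of M are contractions of the tensor on ℂ^m,
those of N and N' their images under G and L. Where det M ≠ 0, Cramer's rule recovers G and L, and S
is then G + ½LᵀL. -/
theorem isAlgebraic_of_diagSlice_mem {R : Subalgebra ℂ (polyFun (ParamSpace m κ))}
    {M N : Matrix (Fin m) (Fin m) (polyFun (ParamSpace m κ))}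
    {N' : Matrix (Fin m) κ (polyFun (ParamSpace m κ))}
    (hR : ∀ t, polyFunOfDual ((paramBasis m κ).coord (Sum.inr (Sum.inr t))) ∈ R)
    (hMR : ∀ i k, M i k ∈ R) (hNR : ∀ i k, N i k ∈ R) (hNR' : ∀ i c, N' i c ∈ R)
    (hM : ∀ i k p, (M i k : ParamSpace m κ → ℂ) p =
      slice (LinearMap.proj i) (LinearMap.proj i) (symCubeCoord m p.2.2) k)
    (hN : ∀ i k p, (N i k : ParamSpace m κ → ℂ) p =
      ∑ j, graphMatrix p.1 p.2.1 k j * (M i j : ParamSpace m κ → ℂ) p)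
    (hN' : ∀ i c p, (N' i c : ParamSpace m κ → ℂ) p =
      ∑ j, p.2.1 c j * (M i j : ParamSpace m κ → ℂ) p) :
    Algebra.IsAlgebraic R (polyFun (ParamSpace m κ)) := by
  obtain ⟨X, hX⟩ : ∃ X : Matrix (Fin m) (Fin m) (polyFun (ParamSpace m κ)),
      ∀ k l p, (X k l : ParamSpace m κ → ℂ) p = graphMatrix p.1 p.2.1 l k :=
    ⟨of fun k l => ⟨fun p => graphMatrix p.1 p.2.1 l k,
      isPolyMap_param_graphMatrix (Matrix.entryLinearMap ℂ ℂ l k)⟩, fun _ _ _ => rfl⟩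
  obtain ⟨Y, hYdef, hY⟩ : ∃ Y : Matrix (Fin m) κ (polyFun (ParamSpace m κ)),
      (∀ k c, Y k c = polyFunOfDual ((paramBasis m κ).coord (Sum.inr (Sum.inl (c, k))))) ∧
      ∀ k c p, (Y k c : ParamSpace m κ → ℂ) p = p.2.1 c k :=
    ⟨of fun k c => polyFunOfDual ((paramBasis m κ).coord (Sum.inr (Sum.inl (c, k)))),
      fun _ _ => rfl, fun k c p => paramBasis_coord_inr_inl c k p⟩
  have hMX : M * X = N := by
    ext i l p
    rw [hN, polyFun_mul_apply]
    exact Finset.sum_congr rfl fun k _ => by rw [hX, mul_comm]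
  have hMY : M * Y = N' := by
    ext i c p
    rw [hN', polyFun_mul_apply]
    exact Finset.sum_congr rfl fun k _ => by rw [hY, mul_comm]
  -- At the tensor ∑ e_i ⊗ e_i ⊗ e_i the matrix M is the identity.
  have hdet : M.det ≠ 0 := by
    obtain ⟨g, hg⟩ := exists_slice_eq_single m
    intro h
    let ev : polyFun (ParamSpace m κ) →+* ℂ :=
      (Pi.evalRingHom (fun _ : ParamSpace m κ => ℂ) (0, 0, g)).comp
        (polyFun (ParamSpace m κ)).val.toRingHom
    have h1 : ev M.det = 0 := by rw [h, map_zero]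
    have h2 : M.map ev = 1 := by
      ext i k
      change (M i k : ParamSpace m κ → ℂ) (0, 0, g) = _
      rw [hM, hg, one_apply, Pi.single_apply]
      simp only [eq_comm]
    rw [RingHom.map_det, RingHom.mapMatrix_apply, h2, det_one] at h1
    exact one_ne_zero h1
  have algX (k l) : IsAlgebraic R (X k l) :=
    have h := det_mul_mem hMR hNR hMX k l
    isAlgebraic_of_mul_mem h.1 hdet h.2
  have algY (k c) : IsAlgebraic R (Y k c) :=
    have h := det_mul_mem hMR hNR' hMY k c
    isAlgebraic_of_mul_mem h.1 hdet h.2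
  refine isAlgebraic_polyFun (paramBasis m κ) ?_
  rintro (q | ⟨c, k⟩ | t)
  · have h : polyFunOfDual ((paramBasis m κ).coord (Sum.inl q)) = X q.1.2 q.1.1 +
        algebraMap ℂ (polyFun (ParamSpace m κ)) (1 / 2) * (Y * Yᵀ) q.1.1 q.1.2 := by
      ext p
      refine (paramBasis_coord_inl q p).trans ?_
      change _ = (X q.1.2 q.1.1 : ParamSpace m κ → ℂ) p +
        (1 / 2) * ((Y * Yᵀ) q.1.1 q.1.2 : ParamSpace m κ → ℂ) p
      have h1 : ((Y * Yᵀ) q.1.1 q.1.2 : ParamSpace m κ → ℂ) p =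
          (p.2.1ᵀ * p.2.1) q.1.1 q.1.2 := by
        rw [polyFun_mul_apply, mul_apply]
        exact Finset.sum_congr rfl fun c _ => by rw [transpose_apply, transpose_apply, hY, hY]
      rw [h1, hX, graphMatrix, Matrix.sub_apply, Matrix.smul_apply, skewMatrix_apply_pair,
        smul_eq_mul, sub_add_cancel]
    rw [h, mul_apply]
    refine (algX _ _).add ((isAlgebraic_algebraMap_complex R _).mul ?_)
    exact (Subalgebra.algebraicClosure R (polyFun (ParamSpace m κ))).sum_mem
      fun c _ => (algY _ c).mul (algY _ c)
  · rw [← hYdef]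
    exact algY k c
  · exact isAlgebraic_algebraMap (⟨_, hR t⟩ : R)

theorem isAlgebraic_comap_param (Φ : V ≃ₗ[ℂ] HypSpace m κ) :
    Algebra.IsAlgebraic (isPolyMap_param Φ).comap.range (polyFun (ParamSpace m κ)) := by
  refine isAlgebraic_of_diagSlice_mem
    (M := of fun i k => (isPolyMap_param Φ).comap
      (polyFunOfDual (LinearMap.proj k ∘ₗ LinearMap.fst ℂ _ _ ∘ₗ diagSlice Φ i)))
    (N := of fun i k => (isPolyMap_param Φ).comap
      (polyFunOfDual (LinearMap.proj k ∘ₗ LinearMap.fst ℂ _ _ ∘ₗ LinearMap.snd ℂ _ _ ∘ₗ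
        diagSlice Φ i)))
    (N' := of fun i c => (isPolyMap_param Φ).comap
      (polyFunOfDual (LinearMap.proj c ∘ₗ LinearMap.snd ℂ _ _ ∘ₗ LinearMap.snd ℂ _ _ ∘ₗ
        diagSlice Φ i)))
    (fun t => ?_) (fun _ _ => ⟨_, rfl⟩) (fun _ _ => ⟨_, rfl⟩) (fun _ _ => ⟨_, rfl⟩)
    (fun i k p => ?_) (fun i k p => ?_) (fun i c p => ?_)
  · obtain ⟨r, hr⟩ := (symCubeCoord m).exists_leftInverse_of_injective
      (LinearMap.ker_eq_bot.2 (symCubeCoord_injective m))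
    -- The first-component projection is a left inverse of the chart embedding, so its third tensor
    -- power recovers the tensor on ℂ^m linearly.
    refine ⟨polyFunOfDual (LinearMap.proj t ∘ₗ r ∘ₗ
      cubeMap (LinearMap.fst ℂ _ _ ∘ₗ Φ.toLinearMap) ∘ₗ (symCube V).subtype),
      Subtype.ext (funext fun p => ?_)⟩
    refine Eq.trans ?_ (paramBasis_coord_inr_inr t p).symm
    change r (cubeMap _ (cubeMap (chartMap Φ p) (symCubeCoord m p.2.2))) t = _
    rw [cubeMap_comp, fst_comp_chartMap, cubeMap_id]
    exact congrFun (LinearMap.congr_fun hr p.2.2) t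
  · change (diagSlice Φ i (param Φ p)).1 k = _
    rw [diagSlice_param, graphMap_apply]
  · change (diagSlice Φ i (param Φ p)).2.1 k = ∑ j, _ * (diagSlice Φ i (param Φ p)).1 j
    rw [diagSlice_param, graphMap_apply]
    rfl
  · change (diagSlice Φ i (param Φ p)).2.2 c = ∑ j, _ * (diagSlice Φ i (param Φ p)).1 j
    rw [diagSlice_param, graphMap_apply]
    rfl

theorem affineDim_varZ [Subsingleton κ] (hΦ : ∀ x y, B x y = hyp (Φ x) (Φ y)) :
    affineDim (varZ B) =
      ((m + 2).choose 3 + (m.choose 2 + Fintype.card κ * m) : ℕ) := by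
  rw [← finrank_paramSpace (m := m) (κ := κ)]
  refine le_antisymm ?_ ?_
  · exact affineDim_le_finrank ⟨_, param_mem_varZ hΦ 0⟩
      (fun I => isPolyMap_param (Φ.trans (hypSwap κ I))) fun T hT => exists_param_eq hΦ hT
  · exact finrank_le_affineDim (isPolyMap_param Φ) (param_mem_varZ hΦ) (isAlgebraic_comap_param Φ)

end Dimension

end Odeco

end

theorem mainTheorem7 (V : Type*) [AddCommGroup V] [Module ℂ V] [FiniteDimensional ℂ V]
    (B : LinearMap.BilinForm ℂ V) (hsymm : B.IsSymm) (hnondeg : B.Nondegenerate)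
    (n : ℕ) (hn : Module.finrank ℂ V = n) :
    Odeco.varZ B = {T | ∃ U : Submodule ℂ V, Odeco.IsIsotropic B U ∧ T ∈ Odeco.symCubeOf U} ∧
    Odeco.varZ B ⊆ Odeco.varX B ∧
    Odeco.IsZariskiClosed (Odeco.varZ B) ∧
    Odeco.affineDim (Odeco.varZ B) =
      (((n / 2 + 2).choose 3 + ((n + 1) / 2).choose 2 : ℕ) : WithBot ℕ∞) := by
  refine ⟨Odeco.varZ_eq, Odeco.varZ_subset_varX, Odeco.isZariskiClosed_varZ hnondeg, ?_⟩
  have hsub : Subsingleton (Fin (n % 2)) :=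
    Fin.subsingleton_iff_le_one.2 (Nat.le_of_lt_succ (Nat.mod_lt n two_pos))
  obtain ⟨Φ, hΦ⟩ := Odeco.exists_isometry_hypSpace (m := n / 2) (κ := Fin (n % 2)) hsymm hnondeg
    (by rw [hn, Fintype.card_fin]; omega)
  rw [Odeco.affineDim_varZ hΦ, Fintype.card_fin]
  congr 3
  -- With m = ⌊n/2⌋, the odd case is Pascal's rule C(m, 2) + m = C(m+1, 2); in the even case the
  -- extra term is 0.
  rcases Nat.mod_two_eq_zero_or_one n with h | h
  · rw [h, zero_mul, add_zero, show (n + 1) / 2 = n / 2 by omega]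
  · rw [h, one_mul, show (n + 1) / 2 = n / 2 + 1 by omega, Nat.choose_succ_succ, Nat.choose_one_right,
      add_comm]
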